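/- For $n\in\mathbb N_0$ let $S_n=\sum_{j=1}^{n}\frac1j-\log(n+1)$, and let $\gamma=\lim_{n\to\infty}S_n$ be Euler's constant. Then for every positive integer $n$, $$\left|\gamma-\frac{((4n)!)^2}{(8n)!}\sum_{k=0}^{8n}(-1)^k\binom{8n}{k}\binom{k+6n}{4n}^2S_{k+4n}\right|<\frac{4n}{(2^4\cdot 3^{12})^n}<4n\,(0.00000012)^n .$$ -/

import Mathlib

/-- The sequence `S_n = 1 + 1/2 + ⋯ + 1/n - log (n + 1)`, which converges to Euler's constant. -/
noncomputable def eulerS (n : ℕ) : ℝ :=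
  (∑ j ∈ Finset.Icc 1 n, (1 : ℝ) / (j : ℝ)) - Real.log ((n : ℝ) + 1)

open Filter Topology MeasureTheory Set

/-! Put `M = 2n` and let `w_k = interpWeight M k`. These are the partial fraction coefficients of
`R(s) = ∑ w_k / (s + k) = P(-s) / ∏ (s + k)`, where `P` is monic of degree `4M` and `P(-s)` has
double zeros at `s = M+1, …, 3M`. The weights sum to the leading coefficient of `P`, which is 1
(`sum_interpWeight`), so the error in the theorem is `∑ w_k (γ - S_{k+2M})`.

The half-integer Binet formula (`harmonic_eq_log_add_binetHalf`) writes `γ - S_m` as `log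
((m+1)/(m+1/2))` minus an integral against `2t / (t² + (m+1/2)²)`. The logarithm is the integral of
`1/(m + 1/2 + d)` over `0 ≤ d ≤ 1/2`, and the Binet kernel is `-2 Im 1/(m + 1/2 + it)`. Both parts
of the error are therefore integrals of `R` along segments or rays from `c = 2M + 1/2`, the centre
of symmetry of the zeros.

On the real segment `|R| ≤ R(c)`. On the vertical ray the numerator grows by at most `cosh² (πt)`,
which the Binet factor `1/(exp (2πt) + 1)` absorbs, and two factors of the denominator make the
integral converge. So the error is at most `R(c)` times a linear function of `M`. Finally `R(c) =
centralValue M` decays geometrically, by comparison of consecutive values (`centralValue_ratio_le`).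
-/

/-! ### Partial fractions of the hyperbolic cotangent and tangent. -/

theorem hasSum_pi_coth {t : ℝ} (ht : 0 < t) :
    HasSum (fun n : ℕ => 2 * t / (t ^ 2 + ((n : ℝ) + 1) ^ 2))
      (Real.pi * (Real.cosh (Real.pi * t) / Real.sinh (Real.pi * t)) - 1 / t) := by
  have hx : (t : ℂ) * Complex.I ∈ Complex.integerComplement := by
    rintro ⟨m, hm⟩
    have := congrArg Complex.im hm
    simp at this
    exact ht.ne this
  have hsum : Summable (fun n : ℕ => 2 * t / (t ^ 2 + ((n : ℝ) + 1) ^ 2)) := by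
    have h1 : Summable (fun n : ℕ => 2 * t * (1 / ((n + 1 : ℕ) : ℝ) ^ 2)) :=
      (((Real.summable_one_div_nat_pow (p := 2)).2 one_lt_two).comp_injective
        (add_left_injective 1)).mul_left _
    refine h1.of_nonneg_of_le (fun n => by positivity) (fun n => ?_)
    rw [mul_one_div]
    push_cast
    gcongr
    nlinarith [sq_nonneg t]
  have key := cot_series_rep' hx
  have hs : Real.sinh (Real.pi * t) ≠ 0 := (Real.sinh_pos_iff.2 (by positivity)).ne'
  rw [hsum.hasSum_iff]
  have hI : Complex.I ≠ 0 := Complex.I_ne_zero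
  have ht' : (t : ℂ) ≠ 0 := by exact_mod_cast ht.ne'
  have e1 : ∀ n : ℕ, (1 / ((t : ℂ) * Complex.I - (n + 1)) + 1 / ((t : ℂ) * Complex.I + (n + 1)))
      = -Complex.I * ((2 * t / (t ^ 2 + ((n : ℝ) + 1) ^ 2) : ℝ) : ℂ) := by
    intro n
    have h1 : (t : ℂ) * Complex.I - (n + 1) ≠ 0 := fun h => by
      have := congrArg Complex.im h
      simp at this
      exact ht.ne' this
    have h2 : (t : ℂ) * Complex.I + (n + 1) ≠ 0 := fun h => by
      have := congrArg Complex.im h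
      simp at this
      exact ht.ne' this
    have h3 : (t : ℂ) ^ 2 + ((n : ℂ) + 1) ^ 2 ≠ 0 := by
      have : (0 : ℝ) < t ^ 2 + ((n : ℝ) + 1) ^ 2 := by positivity
      exact_mod_cast this.ne'
    push_cast
    field_simp
    ring_nf
    simp [Complex.I_pow_three]
  have e2 : (Real.pi : ℂ) * Complex.cot (Real.pi * (t * Complex.I)) - 1 / (t * Complex.I)
      = -Complex.I * ((Real.pi * (Real.cosh (Real.pi * t) / Real.sinh (Real.pi * t)) - 1 / t : ℝ)
        : ℂ) := by
    have hs' : Complex.sinh (Real.pi * t) ≠ 0 := by exact_mod_cast hs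
    rw [Complex.cot, ← mul_assoc, Complex.cos_mul_I, Complex.sin_mul_I]
    push_cast
    field_simp
    simp
  rw [e2, tsum_congr e1, tsum_mul_left, ← Complex.ofReal_tsum] at key
  have := mul_left_cancel₀ (neg_ne_zero.2 hI) key
  exact_mod_cast this.symm

/-- From `tanh s = 2 coth 2s - coth s`: in the cotangent series at `2t` the even integers reproduce
half the series at `t`, and the odd integers leave the half-integer poles. -/
theorem hasSum_pi_tanh {t : ℝ} (ht : 0 < t) :
    HasSum (fun j : ℕ => 2 * t / (t ^ 2 + ((j : ℝ) + 1 / 2) ^ 2))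
      (Real.pi * (Real.sinh (Real.pi * t) / Real.cosh (Real.pi * t))) := by
  have h2 := hasSum_pi_coth (t := 2 * t) (by positivity)
  have h1 := (hasSum_pi_coth ht).mul_left (1 / 2)
  set g : ℕ → ℝ := fun n => 2 * (2 * t) / ((2 * t) ^ 2 + ((n : ℝ) + 1) ^ 2) with hg
  have hodd : HasSum (fun j : ℕ => g (2 * j + 1)) (1 / 2 *
      (Real.pi * (Real.cosh (Real.pi * t) / Real.sinh (Real.pi * t)) - 1 / t)) := by
    have e : ∀ j : ℕ, 1 / 2 * (2 * t / (t ^ 2 + ((j : ℝ) + 1) ^ 2)) = g (2 * j + 1) := fun j => by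
      simp only [hg]
      push_cast
      rw [one_div, inv_mul_eq_div, div_div, div_eq_div_iff (by positivity) (by positivity)]
      ring
    simp_rw [e] at h1
    exact h1
  have heven : Summable (fun j : ℕ => g (2 * j)) :=
    h2.summable.comp_injective (fun a b h => by simpa using h)
  have hS := (heven.hasSum.even_add_odd hodd).unique h2
  have h := heven.hasSum.mul_left 2
  have e : ∀ j, 2 * g (2 * j) = 2 * t / (t ^ 2 + ((j : ℝ) + 1 / 2) ^ 2) := fun j => by
    simp only [hg]
    push_cast
    rw [mul_div_assoc', div_eq_div_iff (by positivity) (by positivity)]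
    ring
  simp_rw [e] at h
  have hv : 2 * ∑' j, g (2 * j) =
      Real.pi * (Real.sinh (Real.pi * t) / Real.cosh (Real.pi * t)) := by
    have hs : Real.sinh (Real.pi * t) ≠ 0 := (Real.sinh_pos_iff.2 (by positivity)).ne'
    have hc : Real.cosh (Real.pi * t) ≠ 0 := (Real.cosh_pos _).ne'
    have e : Real.pi * (2 * t) = 2 * (Real.pi * t) := by ring
    rw [eq_sub_of_add_eq hS, e, Real.cosh_two_mul, Real.sinh_two_mul]
    field_simp
    ring
  exact hv ▸ h

/-! ### Two elementary integrals over the half-line. -/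

theorem integrableOn_and_integral_sq_div_mul {a b : ℝ} (ha : 0 < a) (hb : 0 < b) :
    IntegrableOn (fun t : ℝ => t ^ 2 / ((t ^ 2 + a ^ 2) * (t ^ 2 + b ^ 2))) (Ioi 0) ∧
    ∫ t in Ioi (0 : ℝ), t ^ 2 / ((t ^ 2 + a ^ 2) * (t ^ 2 + b ^ 2)) = Real.pi / (2 * (a + b)) := by
  have hat : ∀ c : ℝ, 0 < c →
      Tendsto (fun t : ℝ => Real.arctan (t / c)) atTop (𝓝 (Real.pi / 2)) := fun c hc =>
    (tendsto_nhds_of_tendsto_nhdsWithin Real.tendsto_arctan_atTop).comp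
      (tendsto_id.atTop_div_const hc)
  have hder : ∀ c : ℝ, 0 < c → ∀ t : ℝ,
      HasDerivAt (fun t : ℝ => Real.arctan (t / c)) (c / (t ^ 2 + c ^ 2)) t := fun c hc t => by
    convert ((hasDerivAt_id' t).div_const c).arctan using 1
    field_simp
    ring
  have hpos : ∀ t ∈ Ioi (0 : ℝ), 0 ≤ t ^ 2 / ((t ^ 2 + a ^ 2) * (t ^ 2 + b ^ 2)) :=
    fun t _ => by positivity
  suffices ∃ F : ℝ → ℝ, F 0 = 0 ∧ (∀ t, HasDerivAt F
      (t ^ 2 / ((t ^ 2 + a ^ 2) * (t ^ 2 + b ^ 2))) t) ∧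
      Tendsto F atTop (𝓝 (Real.pi / (2 * (a + b)))) by
    obtain ⟨F, h0, hF, hl⟩ := this
    refine ⟨integrableOn_Ioi_deriv_of_nonneg' (fun t _ => hF t) hpos hl, ?_⟩
    rw [integral_Ioi_of_hasDerivAt_of_nonneg' (fun t _ => hF t) hpos hl, h0, sub_zero]
  -- The case `a = b` does occur: the Binet formula is used at half-integers `x`, which coincide
  -- with some `j + 1/2`.
  rcases eq_or_ne a b with rfl | hab
  · refine ⟨fun t => (1 / 2) * (Real.arctan (t / a) / a - t / (t ^ 2 + a ^ 2)), by simp,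
      fun t => ?_, ?_⟩
    · have hne : t ^ 2 + a ^ 2 ≠ 0 := by positivity
      refine ((((hder a ha t).div_const a).sub ((hasDerivAt_id' t).fun_div
        ((hasDerivAt_pow 2 t).add_const (a ^ 2)) hne)).const_mul (1 / 2)).congr_deriv ?_
      field_simp
      ring
    · have h0 : Tendsto (fun t : ℝ => t / (t ^ 2 + a ^ 2)) atTop (𝓝 0) := by
        refine squeeze_zero' (g := fun t => t⁻¹) ?_ ?_ tendsto_inv_atTop_zero
        · filter_upwards [eventually_ge_atTop 0] with t ht
          positivity
        · filter_upwards [eventually_gt_atTop 0] with t ht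
          rw [inv_eq_one_div, div_le_div_iff₀ (by positivity) ht]
          nlinarith [sq_nonneg a]
      have hv : 1 / 2 * (Real.pi / 2 / a - 0) = Real.pi / (2 * (a + a)) := by
        field_simp
        ring
      exact hv ▸ (((hat a ha).div_const a).sub h0).const_mul (1 / 2)
  · have hd : a ^ 2 - b ^ 2 ≠ 0 := by
      rw [sq_sub_sq]
      exact mul_ne_zero (by positivity) (sub_ne_zero.2 hab)
    have hd' : a - b ≠ 0 := sub_ne_zero.2 hab
    refine ⟨fun t => (a * Real.arctan (t / a) - b * Real.arctan (t / b)) / (a ^ 2 - b ^ 2),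
      by simp, fun t => ?_, ?_⟩
    · refine ((((hder a ha t).const_mul a).sub ((hder b hb t).const_mul b)).div_const
        (a ^ 2 - b ^ 2)).congr_deriv ?_
      have h1 : t ^ 2 + a ^ 2 ≠ 0 := by positivity
      have h2 : t ^ 2 + b ^ 2 ≠ 0 := by positivity
      field_simp
      ring
    · have hv : (a * (Real.pi / 2) - b * (Real.pi / 2)) / (a ^ 2 - b ^ 2) =
          Real.pi / (2 * (a + b)) := by
        rw [sq_sub_sq, ← sub_mul]
        have : a + b ≠ 0 := by positivity
        field_simp
      exact hv ▸ (((hat a ha).const_mul a).sub ((hat b hb).const_mul b)).div_const (a ^ 2 - b ^ 2)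

/-- Neither term is integrable alone, which is why the Binet integral is studied through its
differences. -/
theorem integrableOn_and_integral_mul_inv_sub_inv {x y : ℝ} (hx : 0 < x) (hxy : x ≤ y) :
    IntegrableOn (fun t : ℝ => 2 * t * (1 / (t ^ 2 + x ^ 2) - 1 / (t ^ 2 + y ^ 2))) (Ioi 0) ∧
    ∫ t in Ioi (0 : ℝ), 2 * t * (1 / (t ^ 2 + x ^ 2) - 1 / (t ^ 2 + y ^ 2)) =
      2 * Real.log (y / x) := by
  have hy : 0 < y := hx.trans_le hxy
  have hpos : ∀ t ∈ Ioi (0 : ℝ), 0 ≤ 2 * t * (1 / (t ^ 2 + x ^ 2) - 1 / (t ^ 2 + y ^ 2)) := by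
    intro t ht
    have : 0 < t := ht
    refine mul_nonneg (by positivity) (sub_nonneg.2 ?_)
    gcongr
  have hder : ∀ t ∈ Ici (0 : ℝ), HasDerivAt (fun t => Real.log ((t ^ 2 + x ^ 2) / (t ^ 2 + y ^ 2)))
      (2 * t * (1 / (t ^ 2 + x ^ 2) - 1 / (t ^ 2 + y ^ 2))) t := by
    intro t _
    have h1 : t ^ 2 + x ^ 2 ≠ 0 := by positivity
    have h2 : t ^ 2 + y ^ 2 ≠ 0 := by positivity
    convert (((hasDerivAt_pow 2 t).add_const (x ^ 2)).fun_div
      ((hasDerivAt_pow 2 t).add_const (y ^ 2)) h2).log (div_ne_zero h1 h2) using 1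
    field_simp
    ring
  have hlim : Tendsto (fun t : ℝ => Real.log ((t ^ 2 + x ^ 2) / (t ^ 2 + y ^ 2))) atTop (𝓝 0) := by
    rw [← Real.log_one]
    refine (Real.continuousAt_log one_ne_zero).tendsto.comp ?_
    have h0 : Tendsto (fun t : ℝ => (y ^ 2 - x ^ 2) / (t ^ 2 + y ^ 2)) atTop (𝓝 0) :=
      (tendsto_atTop_add_const_right _ _ (tendsto_pow_atTop two_ne_zero)).const_div_atTop _
    have h1 := h0.const_sub 1
    rw [sub_zero] at h1
    refine h1.congr fun t => ?_
    have h2 : t ^ 2 + y ^ 2 ≠ 0 := by positivity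
    field_simp
    ring
  refine ⟨integrableOn_Ioi_deriv_of_nonneg' hder hpos hlim, ?_⟩
  rw [integral_Ioi_of_hasDerivAt_of_nonneg' hder hpos hlim]
  have : (0 ^ 2 + x ^ 2) / (0 ^ 2 + y ^ 2) = ((y / x) ^ 2)⁻¹ := by
    field_simp
    ring
  rw [this, Real.log_inv, Real.log_pow]
  push_cast
  ring

/-! ### The Binet formula at half-integers. -/

/-- The remainder term in the half-integer Binet formula
`digamma (x + 1 / 2) = log x + binetHalf x`. -/
noncomputable def binetHalf (x : ℝ) : ℝ :=
  ∫ t in Ioi (0 : ℝ), 2 * t / (t ^ 2 + x ^ 2) / (Real.exp (2 * Real.pi * t) + 1)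

theorem inv_exp_two_mul_add_one (s : ℝ) :
    1 / (Real.exp (2 * s) + 1) = 1 / 2 - Real.sinh s / Real.cosh s / 2 := by
  have hc : Real.cosh s ≠ 0 := (Real.cosh_pos _).ne'
  have h1 : Real.exp (2 * s) + 1 ≠ 0 := by positivity
  have h2 : Real.exp (2 * s) = Real.exp s * Real.exp s := by rw [← Real.exp_add, two_mul]
  have h3 : Real.exp s * Real.exp (-s) = 1 := by rw [← Real.exp_add]; simp
  rw [Real.cosh_eq] at hc ⊢
  rw [Real.sinh_eq]
  have h4 : Real.exp s + Real.exp (-s) ≠ 0 := by positivity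
  field_simp
  rw [h2]
  linear_combination (-2 * Real.exp s) * h3

theorem integrableOn_inv_exp_two_pi_add_one :
    IntegrableOn (fun t : ℝ => 1 / (Real.exp (2 * Real.pi * t) + 1)) (Ioi 0) := by
  refine (integrableOn_exp_mul_Ioi (a := -(2 * Real.pi)) (by simp [Real.pi_pos]) 0).mono'
    (Continuous.aestronglyMeasurable (by fun_prop (disch := intro; positivity))) (ae_of_all _ fun t => ?_)
  rw [Real.norm_of_nonneg (by positivity), neg_mul, Real.exp_neg, one_div]
  gcongr
  simp

theorem integrableOn_binetHalf {x : ℝ} (hx : 0 < x) :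
    IntegrableOn (fun t : ℝ => 2 * t / (t ^ 2 + x ^ 2) / (Real.exp (2 * Real.pi * t) + 1))
      (Ioi 0) := by
  refine (integrableOn_inv_exp_two_pi_add_one.const_mul (1 / x)).mono' ?_ ?_
  · refine Continuous.aestronglyMeasurable ?_
    fun_prop (disch := intro; positivity)
  · refine (ae_restrict_iff' measurableSet_Ioi).2 (ae_of_all _ fun t ht => ?_)
    have ht : 0 < t := ht
    rw [Real.norm_of_nonneg (by positivity), div_eq_mul_one_div]
    gcongr ?_ * _
    rw [div_le_div_iff₀ (by positivity) hx]
    nlinarith [sq_nonneg (t - x)]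

theorem binetHalf_nonneg (x : ℝ) : 0 ≤ binetHalf x := by
  refine setIntegral_nonneg measurableSet_Ioi fun t ht => ?_
  have ht : 0 < t := ht
  positivity

theorem binetHalf_le {x : ℝ} (hx : 0 < x) :
    binetHalf x ≤ 1 / x * ∫ t in Ioi (0 : ℝ), 1 / (Real.exp (2 * Real.pi * t) + 1) := by
  rw [← integral_const_mul]
  refine setIntegral_mono_on (integrableOn_binetHalf hx)
    (integrableOn_inv_exp_two_pi_add_one.const_mul (1 / x)) measurableSet_Ioi fun t ht => ?_
  have ht : 0 < t := ht
  rw [div_eq_mul_one_div]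
  gcongr ?_ * _
  rw [div_le_div_iff₀ (by positivity) hx]
  nlinarith [sq_nonneg (t - x)]

theorem hasSum_telescoping_inv {x : ℝ} (hx : 0 < x) :
    HasSum (fun j : ℕ => 1 / (x + (j + 1 / 2)) - 1 / (x + 1 + (j + 1 / 2))) (1 / (x + 1 / 2)) := by
  have hnn : ∀ j : ℕ, 0 ≤ 1 / (x + (j + 1 / 2)) - 1 / (x + 1 + (j + 1 / 2)) := fun j => by
    rw [sub_nonneg]
    gcongr
    linarith
  rw [hasSum_iff_tendsto_nat_of_nonneg hnn]
  have hs : ∀ n : ℕ, ∑ j ∈ Finset.range n,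
      (1 / (x + (j + 1 / 2)) - 1 / (x + 1 + ((j : ℝ) + 1 / 2))) =
      1 / (x + 1 / 2) - 1 / (n + (x + 1 / 2)) := fun n => by
    have := Finset.sum_range_sub' (fun j : ℕ => 1 / (x + ((j : ℝ) + 1 / 2))) n
    push_cast at this
    convert this using 1
    · refine Finset.sum_congr rfl fun j _ => ?_
      ring_nf
    · ring_nf
  simp_rw [hs]
  have : Tendsto (fun n : ℕ => 1 / ((n : ℝ) + (x + 1 / 2))) atTop (𝓝 0) :=
    (tendsto_atTop_add_const_right _ _ tendsto_natCast_atTop_atTop).const_div_atTop _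
  simpa using this.const_sub (1 / (x + 1 / 2))

/-- Write `1/(exp (2πt) + 1) = 1/2 - tanh (πt)/2`. The constant `1/2` gives the logarithm; the
tangent series, integrated term by term, gives a telescoping series with sum `1/(x + 1/2)`. -/
theorem binetHalf_sub_binetHalf_add_one {x : ℝ} (hx : 0 < x) :
    binetHalf x - binetHalf (x + 1) = Real.log ((x + 1) / x) - 1 / (x + 1 / 2) := by
  have hy : 0 < x + 1 := by positivity
  obtain ⟨hL, hL'⟩ := integrableOn_and_integral_mul_inv_sub_inv hx (by linarith : x ≤ x + 1)
  set F : ℕ → ℝ → ℝ := fun j t => 1 / Real.pi *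
    (2 * (t ^ 2 / ((t ^ 2 + x ^ 2) * (t ^ 2 + (j + 1 / 2) ^ 2)) -
      t ^ 2 / ((t ^ 2 + (x + 1) ^ 2) * (t ^ 2 + (j + 1 / 2) ^ 2)))) with hF
  have hFi : ∀ j, IntegrableOn (F j) (Ioi 0) := fun j =>
    (((integrableOn_and_integral_sq_div_mul hx (by positivity)).1.sub
      (integrableOn_and_integral_sq_div_mul hy (by positivity)).1).const_mul _).const_mul _
  have hFI : ∀ j, ∫ t in Ioi (0 : ℝ), F j t =
      1 / (x + (j + 1 / 2)) - 1 / (x + 1 + (j + 1 / 2)) := fun j => by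
    have h1 := integrableOn_and_integral_sq_div_mul hx (b := (j : ℝ) + 1 / 2) (by positivity)
    have h2 := integrableOn_and_integral_sq_div_mul hy (b := (j : ℝ) + 1 / 2) (by positivity)
    simp only [hF]
    rw [integral_const_mul, integral_const_mul, integral_sub h1.1 h2.1, h1.2, h2.2]
    field_simp
  have hFn : ∀ j, ∫ t in Ioi (0 : ℝ), ‖F j t‖ =
      1 / (x + (j + 1 / 2)) - 1 / (x + 1 + (j + 1 / 2)) := fun j => by
    rw [← hFI]
    -- The terms are nonnegative, so the same telescoping series justifies exchanging sum and
    -- integral.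
    refine setIntegral_congr_fun measurableSet_Ioi fun t ht => Real.norm_of_nonneg ?_
    refine mul_nonneg (by positivity) (mul_nonneg two_pos.le (sub_nonneg.2 ?_))
    gcongr
    linarith
  have hsum := hasSum_integral_of_summable_integral_norm hFi
    (by simp_rw [hFn]; exact (hasSum_telescoping_inv hx).summable)
  simp_rw [hFI] at hsum
  have hI := hsum.unique (hasSum_telescoping_inv hx)
  have hpt : ∀ t ∈ Ioi (0 : ℝ), 2 * t / (t ^ 2 + x ^ 2) / (Real.exp (2 * Real.pi * t) + 1) -
      2 * t / (t ^ 2 + (x + 1) ^ 2) / (Real.exp (2 * Real.pi * t) + 1) =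
      1 / 2 * (2 * t * (1 / (t ^ 2 + x ^ 2) - 1 / (t ^ 2 + (x + 1) ^ 2))) - ∑' j, F j t := by
    intro t ht
    have ht : 0 < t := ht
    have hT := ((hasSum_pi_tanh ht).mul_left (1 / Real.pi *
      (t * (1 / (t ^ 2 + x ^ 2) - 1 / (t ^ 2 + (x + 1) ^ 2))))).tsum_eq
    have hFT : ∑' j, F j t = 1 / Real.pi *
        (t * (1 / (t ^ 2 + x ^ 2) - 1 / (t ^ 2 + (x + 1) ^ 2))) *
        (Real.pi * (Real.sinh (Real.pi * t) / Real.cosh (Real.pi * t))) := by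
      rw [← hT]
      refine tsum_congr fun j => ?_
      simp only [hF]
      field_simp
    have hE : ∀ A : ℝ, A / (Real.exp (2 * Real.pi * t) + 1) =
        A * (1 / 2 - Real.sinh (Real.pi * t) / Real.cosh (Real.pi * t) / 2) := fun A => by
      rw [← inv_exp_two_mul_add_one, mul_one_div, mul_assoc]
    rw [hFT, hE, hE]
    have := Real.pi_pos.ne'
    have hc : Real.cosh (Real.pi * t) ≠ 0 := (Real.cosh_pos _).ne'
    field_simp
  rw [binetHalf, binetHalf, ← integral_sub (integrableOn_binetHalf hx) (integrableOn_binetHalf hy),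
    setIntegral_congr_fun measurableSet_Ioi hpt, integral_sub (hL.const_mul _) ?_,
    integral_const_mul, hL', hI]
  · ring
  · have hd := (hL.const_mul (1 / 2)).sub
      ((integrableOn_binetHalf hx).sub (integrableOn_binetHalf hy))
    refine (integrableOn_congr_fun (fun t ht => ?_) measurableSet_Ioi).1 hd
    simp only [Pi.sub_apply, hpt t ht]
    ring

/-- By the difference equation of `binetHalf`, the defect `D m` does not depend on `m`; its limit
identifies it as Euler's constant. -/
theorem harmonic_eq_log_add_binetHalf (m : ℕ) :
    (harmonic m : ℝ) =
      Real.log (m + 1 / 2) + Real.eulerMascheroniConstant + binetHalf (m + 1 / 2) := by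
  set D : ℕ → ℝ := fun m => (harmonic m : ℝ) - Real.log (m + 1 / 2) - binetHalf (m + 1 / 2) with hD
  have hstep : ∀ m, D (m + 1) = D m := fun m => by
    have h := binetHalf_sub_binetHalf_add_one (x := (m : ℝ) + 1 / 2) (by positivity)
    rw [Real.log_div (by positivity) (by positivity)] at h
    simp only [hD, harmonic_succ]
    push_cast
    rw [show (m : ℝ) + 1 / 2 + 1 / 2 = m + 1 by ring, one_div ((m : ℝ) + 1)] at h
    rw [show (m : ℝ) + 1 + 1 / 2 = m + 1 / 2 + 1 by ring]
    linarith
  have hconst : ∀ m, D m = D 0 := fun m => by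
    induction m with
    | zero => rfl
    | succ k ih => rw [hstep, ih]
  have hB : Tendsto (fun m : ℕ => binetHalf (m + 1 / 2)) atTop (𝓝 0) := by
    refine squeeze_zero (fun m => binetHalf_nonneg _)
      (fun m => binetHalf_le (by positivity)) ?_
    have : Tendsto (fun n : ℕ => 1 / ((n : ℝ) + 1 / 2)) atTop (𝓝 0) :=
      (tendsto_atTop_add_const_right _ _ tendsto_natCast_atTop_atTop).const_div_atTop _
    simpa using this.mul_const (∫ t in Ioi (0 : ℝ), 1 / (Real.exp (2 * Real.pi * t) + 1))
  have hlog : Tendsto (fun m : ℕ => Real.log (m + 1 / 2) - Real.log m) atTop (𝓝 0) :=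
    (Real.tendsto_log_comp_add_sub_log (1 / 2)).comp tendsto_natCast_atTop_atTop
  have hlim : Tendsto D atTop (𝓝 Real.eulerMascheroniConstant) := by
    have := (Real.tendsto_harmonic_sub_log.sub hlog).sub hB
    simp only [sub_zero] at this
    refine this.congr fun m => ?_
    simp only [hD]
    ring
  have h0 : D 0 = Real.eulerMascheroniConstant :=
    tendsto_nhds_unique (tendsto_const_nhds.congr fun m => (hconst m).symm) hlim
  have := hconst m
  rw [h0] at this
  simp only [hD] at this
  linarith

/-! ### Euler products and growth along the imaginary direction. -/

theorem tendsto_euler_sinh_prod (t : ℝ) :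
    Tendsto (fun n : ℕ => Real.pi * t * ∏ j ∈ Finset.range n, (1 + t ^ 2 / ((j : ℝ) + 1) ^ 2))
      atTop (𝓝 (Real.sinh (Real.pi * t))) := by
  have h := (Complex.continuous_im.tendsto _).comp (Complex.tendsto_euler_sin_prod (t * Complex.I))
  rw [← mul_assoc, Complex.sin_mul_I, Complex.mul_I_im, ← Complex.ofReal_mul, Complex.sinh_ofReal_re]
    at h
  refine h.congr fun n => ?_
  have : ∏ j ∈ Finset.range n, ((1 : ℂ) - (t * Complex.I) ^ 2 / ((j : ℂ) + 1) ^ 2) =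
      ((∏ j ∈ Finset.range n, (1 + t ^ 2 / ((j : ℝ) + 1) ^ 2) : ℝ) : ℂ) := by
    push_cast
    refine Finset.prod_congr rfl fun j _ => ?_
    rw [mul_pow, Complex.I_sq]
    ring
  simp only [Function.comp_apply, this]
  rw [mul_right_comm, Complex.mul_I_im, ← Complex.ofReal_mul, Complex.ofReal_re]

theorem prod_range_two_mul_one_add_sq_div (t : ℝ) (n : ℕ) :
    ∏ j ∈ Finset.range (2 * n), (1 + (2 * t) ^ 2 / ((j : ℝ) + 1) ^ 2) =
      (∏ j ∈ Finset.range n, (1 + t ^ 2 / ((j : ℝ) + 1) ^ 2)) *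
        ∏ j ∈ Finset.range n, (1 + t ^ 2 / ((j : ℝ) + 1 / 2) ^ 2) := by
  induction n with
  | zero => simp
  | succ n ih =>
    rw [show 2 * (n + 1) = 2 * n + 1 + 1 by ring, Finset.prod_range_succ, Finset.prod_range_succ, ih,
      Finset.prod_range_succ, Finset.prod_range_succ]
    have h1 : 1 + (2 * t) ^ 2 / (((2 * n : ℕ) : ℝ) + 1) ^ 2 = 1 + t ^ 2 / ((n : ℝ) + 1 / 2) ^ 2 := by
      push_cast
      rw [add_right_inj, div_eq_div_iff (by positivity) (by positivity)]
      ring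
    have h2 : 1 + (2 * t) ^ 2 / (((2 * n + 1 : ℕ) : ℝ) + 1) ^ 2 = 1 + t ^ 2 / ((n : ℝ) + 1) ^ 2 := by
      push_cast
      rw [add_right_inj, div_eq_div_iff (by positivity) (by positivity)]
      ring
    rw [h1, h2]
    ring

/-- The partial products increase, and their limit is `sinh (2πt) / (2 sinh (πt))`, the quotient of
two Euler products whose common factors cancel. -/
theorem prod_one_add_sq_div_le_cosh {t : ℝ} (ht : 0 < t) (n : ℕ) :
    ∏ j ∈ Finset.range n, (1 + t ^ 2 / ((j : ℝ) + 1 / 2) ^ 2) ≤ Real.cosh (Real.pi * t) := by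
  have hs : 0 < Real.sinh (Real.pi * t) := Real.sinh_pos_iff.2 (by positivity)
  have h1 := tendsto_euler_sinh_prod t
  have h2 := (tendsto_euler_sinh_prod (2 * t)).comp
    (tendsto_id.const_mul_atTop' (r := 2) two_pos)
  have hlim : Tendsto (fun n : ℕ => ∏ j ∈ Finset.range n, (1 + t ^ 2 / ((j : ℝ) + 1 / 2) ^ 2)) atTop
      (𝓝 (Real.cosh (Real.pi * t))) := by
    have hv : Real.sinh (Real.pi * (2 * t)) / (2 * Real.sinh (Real.pi * t)) =
        Real.cosh (Real.pi * t) := by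
      rw [show Real.pi * (2 * t) = 2 * (Real.pi * t) by ring, Real.sinh_two_mul]
      field_simp
    rw [← hv]
    refine (h2.div (h1.const_mul 2) (by positivity)).congr fun n => ?_
    simp only [Function.comp_apply, id, Pi.div_apply, prod_range_two_mul_one_add_sq_div]
    have h3 : ∏ j ∈ Finset.range n, (1 + t ^ 2 / ((j : ℝ) + 1) ^ 2) ≠ 0 :=
      Finset.prod_ne_zero_iff.2 fun j _ => by positivity
    field_simp
  refine (monotone_nat_of_le_succ fun n => ?_).ge_of_tendsto hlim n
  rw [Finset.prod_range_succ]
  exact le_mul_of_one_le_right (Finset.prod_nonneg fun j _ => by positivity)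
    (le_add_of_nonneg_right (by positivity))

theorem prod_sq_add_sq_le {t : ℝ} (ht : 0 < t) (n : ℕ) :
    ∏ j ∈ Finset.range n, (((j : ℝ) + 1 / 2) ^ 2 + t ^ 2) ≤
      (∏ j ∈ Finset.range n, ((j : ℝ) + 1 / 2) ^ 2) * Real.cosh (Real.pi * t) := by
  refine le_trans (le_of_eq ?_) (mul_le_mul_of_nonneg_left (prod_one_add_sq_div_le_cosh ht n)
    (Finset.prod_nonneg fun j _ => by positivity))
  rw [← Finset.prod_mul_distrib]
  refine Finset.prod_congr rfl fun j _ => ?_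
  field_simp

theorem two_mul_cosh_sq_le (s : ℝ) (hs : 0 ≤ s) : 2 * Real.cosh s ^ 2 ≤ Real.exp (2 * s) + 1 := by
  have h1 : Real.exp (-(2 * s)) ≤ Real.exp (2 * s) := Real.exp_le_exp.2 (by linarith)
  have h2 := Real.cosh_sq s
  have h3 := Real.cosh_two_mul s
  rw [Real.cosh_eq] at h3
  linarith

/-! ### Lagrange interpolation at the nodes `0, …, N`. -/

theorem prod_erase_range_natCast_sub {K : Type*} [Field K] {N k : ℕ} (hk : k ∈ Finset.range (N + 1)) :
    ∏ j ∈ (Finset.range (N + 1)).erase k, ((k : K) - j) =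
      (-1) ^ (N - k) * ((k.factorial : K) * ((N - k).factorial : K)) := by
  obtain ⟨m, rfl⟩ := Nat.exists_eq_add_of_le (Nat.lt_succ_iff.1 (Finset.mem_range.1 hk))
  have h : ∏ j ∈ (Finset.range (k + m + 1)).erase k, ((k : K) - j) =
      ∏ j ∈ Finset.range (k + (m + 1)), if j = k then (1 : K) else (k : K) - j := by
    rw [← add_assoc, ← Finset.mul_prod_erase _ _ hk, if_pos rfl, one_mul]
    exact Finset.prod_congr rfl fun j hj => (if_neg (Finset.ne_of_mem_erase hj)).symm
  rw [h, Finset.prod_range_add, Finset.prod_range_succ', Nat.add_sub_cancel_left]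
  have h1 : ∏ j ∈ Finset.range k, (if j = k then (1 : K) else (k : K) - j) = k.factorial := by
    rw [← Finset.prod_range_add_one_eq_factorial, ← Finset.prod_range_reflect, Nat.cast_prod]
    refine Finset.prod_congr rfl fun j hj => ?_
    have hj := Finset.mem_range.1 hj
    rw [if_neg (by omega), show k - 1 - j = k - (j + 1) by omega, Nat.cast_sub (by omega)]
    push_cast
    ring
  have h2 : ∏ j ∈ Finset.range m,
      (if k + (j + 1) = k then (1 : K) else (k : K) - (k + (j + 1) : ℕ)) =
      (-1) ^ m * m.factorial := by
    have e : ∀ j : ℕ, (if k + (j + 1) = k then (1 : K) else (k : K) - (k + (j + 1) : ℕ)) =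
        -1 * ((j + 1 : ℕ) : K) := fun j => by
      rw [if_neg (by omega)]
      push_cast
      ring
    rw [← Finset.prod_range_add_one_eq_factorial, Nat.cast_prod, Finset.prod_congr rfl fun j _ => e j,
      Finset.prod_mul_distrib, Finset.prod_const, Finset.card_range]
  rw [h1, h2]
  simp
  ring

theorem factorial_mul_prod_erase_inv {K : Type*} [Field K] [CharZero K] {N k : ℕ}
    (hk : k ∈ Finset.range (N + 1)) :
    (N.factorial : K) * (∏ j ∈ (Finset.range (N + 1)).erase k, ((k : K) - j))⁻¹ =
      (-1) ^ (N - k) * (N.choose k : K) := by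
  have h := Nat.choose_mul_factorial_mul_factorial (Nat.lt_succ_iff.1 (Finset.mem_range.1 hk))
  have h1 : (k.factorial : K) ≠ 0 := Nat.cast_ne_zero.2 k.factorial_ne_zero
  have h2 : ((N - k).factorial : K) ≠ 0 := Nat.cast_ne_zero.2 (N - k).factorial_ne_zero
  have h3 : ((-1 : K) ^ (N - k)) * (-1) ^ (N - k) = 1 := by
    rw [← mul_pow]; simp
  rw [prod_erase_range_natCast_sub hk, ← h]
  push_cast
  have h4 : ((-1 : K) ^ (N - k)) ≠ 0 := pow_ne_zero _ (neg_ne_zero.2 one_ne_zero)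
  field_simp
  rw [sq, h3, mul_one]

/-- The `N`-th finite difference of a polynomial of degree at most `N` sees only its top
coefficient. -/
theorem sum_choose_mul_eval {K : Type*} [Field K] [CharZero K] {N : ℕ} {P : Polynomial K}
    (hP : P.natDegree ≤ N) :
    ∑ k ∈ Finset.range (N + 1), (-1) ^ (N - k) * (N.choose k : K) * P.eval (k : K) =
      N.factorial * P.coeff N := by
  have hlt : P.degree < (Finset.range (N + 1)).card := by
    rw [Finset.card_range]
    exact lt_of_le_of_lt Polynomial.degree_le_natDegree (by exact_mod_cast Nat.lt_succ_of_le hP)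
  have h := Lagrange.coeff_eq_sum (v := fun k : ℕ => (k : K))
    (Nat.cast_injective.injOn) hlt
  rw [Finset.card_range, Nat.add_sub_cancel] at h
  rw [h, Finset.mul_sum]
  refine Finset.sum_congr rfl fun k hk => ?_
  rw [← factorial_mul_prod_erase_inv hk, div_eq_mul_inv]
  ring

/-- Lagrange's formula for `P` evaluated at `-s`, divided by the nodal polynomial: this is a partial
fraction expansion. -/
theorem sum_choose_mul_eval_div {K : Type*} [Field K] [CharZero K] {N : ℕ} {P : Polynomial K}
    (hP : P.natDegree ≤ N) {s : K} (hs : ∀ k : ℕ, s + k ≠ 0) :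
    ∑ k ∈ Finset.range (N + 1), (-1) ^ k * (N.choose k : K) * P.eval (k : K) / (s + k) =
      N.factorial * P.eval (-s) / ∏ k ∈ Finset.range (N + 1), (s + k) := by
  have hlt : P.degree < (Finset.range (N + 1)).card := by
    rw [Finset.card_range]
    exact lt_of_le_of_lt Polynomial.degree_le_natDegree (by exact_mod_cast Nat.lt_succ_of_le hP)
  have h := Lagrange.eval_interpolate_not_at_node (s := Finset.range (N + 1))
    (v := fun k : ℕ => (k : K)) (fun k => P.eval (k : K)) (x := -s)
    (fun k _ h => hs k (by rw [← h]; ring))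
  rw [← Lagrange.eq_interpolate (Nat.cast_injective.injOn) hlt, Lagrange.eval_nodal] at h
  have hn : ∏ k ∈ Finset.range (N + 1), (-s - (k : K)) =
      (-1) ^ (N + 1) * ∏ k ∈ Finset.range (N + 1), (s + k) := by
    rw [Finset.prod_congr rfl fun (k : ℕ) _ => show -s - (k : K) = -1 * (s + k) by ring,
      Finset.prod_mul_distrib, Finset.prod_const, Finset.card_range]
  have h0 : ∏ k ∈ Finset.range (N + 1), (s + k) ≠ 0 := Finset.prod_ne_zero_iff.2 fun k _ => hs k
  rw [h, hn, eq_div_iff h0, mul_comm _ (∏ k ∈ Finset.range (N + 1), (s + k)), mul_comm ((-1) ^ _),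
    mul_assoc (∏ k ∈ Finset.range (N + 1), (s + k)), mul_left_comm (N.factorial : K)]
  congr 1
  rw [Finset.mul_sum, Finset.mul_sum]
  refine Finset.sum_congr rfl fun k hk => ?_
  have hle := Nat.lt_succ_iff.1 (Finset.mem_range.1 hk)
  -- The three signs come from the nodal polynomial, the nodal weight and `1/(-s - k)`.
  have hsg : (-1 : K) ^ k = (-1) ^ (N + 1) * (-1) ^ (N - k) * (-1) := by
    rw [← pow_add, ← pow_succ, show N + 1 + (N - k) + 1 = k + 2 * (N + 1 - k) by omega, pow_add,
      pow_mul]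
    simp
  have hinv : (-s - (k : K))⁻¹ = -(s + k)⁻¹ := by
    rw [← inv_neg]; congr 1; ring
  rw [hsg, Lagrange.nodalWeight, Finset.prod_inv_distrib, hinv, div_eq_mul_inv]
  linear_combination ((-1) ^ (N + 1) * (s + k)⁻¹ * P.eval (k : K)) *
    factorial_mul_prod_erase_inv (K := K) hk

/-! ### The weights and their rational function. -/

/-- Pairs `2M` consecutive factors outward from their midpoint; this links the binomials in the
weights to the symmetric form of `interpPoly`. -/
theorem prod_sub_mul_add_eq_ascFactorial {R : Type*} [CommRing R] (M : ℕ) (b : R) :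
    ∏ j ∈ Finset.range M, ((b + M - j) * (b + M + 1 + j)) =
      ∏ i ∈ Finset.range (2 * M), (b + 1 + i) := by
  induction M generalizing b with
  | zero => simp
  | succ M ih =>
    rw [show 2 * (M + 1) = 2 * M + 1 + 1 by ring, Finset.prod_range_succ, Finset.prod_range_succ,
      Finset.prod_range_succ']
    have h : ∏ i ∈ Finset.range (2 * M), (b + 1 + ((i + 1 : ℕ) : R)) =
        ∏ i ∈ Finset.range (2 * M), (b + 1 + 1 + i) :=
      Finset.prod_congr rfl fun i _ => by push_cast; ring
    have h' : ∏ j ∈ Finset.range M, ((b + (M + 1 : ℕ) - j) * (b + (M + 1 : ℕ) + 1 + j)) =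
        ∏ j ∈ Finset.range M, ((b + 1 + M - j) * (b + 1 + M + 1 + j)) :=
      Finset.prod_congr rfl fun i _ => by push_cast; ring
    rw [h, h', ih (b + 1)]
    push_cast
    ring

/-- The interpolation weights: the coefficients of `1 / (s + k)` in the partial fraction expansion
of a rational function with `2 * M` double zeros placed symmetrically around `2 * M + 1 / 2`. -/
noncomputable def interpWeight (M k : ℕ) : ℝ :=
  (-1) ^ k * ((4 * M).choose k : ℝ) *
    (((2 * M).factorial : ℝ) * ((k + 3 * M).choose (2 * M) : ℝ)) ^ 2 / ((4 * M).factorial : ℝ)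

open Polynomial in
/-- The monic polynomial of degree `4 * M` interpolated by the weights. -/
noncomputable def interpPoly (M : ℕ) : ℂ[X] :=
  ∏ j ∈ Finset.range M, ((X + C (2 * M + 1 / 2 : ℂ)) ^ 2 - C (((j : ℂ) + 1 / 2) ^ 2)) ^ 2

open Polynomial in
theorem interpPoly_monic_natDegree (M : ℕ) :
    (interpPoly M).Monic ∧ (interpPoly M).natDegree = 4 * M := by
  have h1 : ∀ j : ℕ,
      ((X + C (2 * M + 1 / 2 : ℂ)) ^ 2 - C (((j : ℂ) + 1 / 2) ^ 2) : ℂ[X]).Monic := fun j => by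
    refine ((monic_X_add_C _).pow 2).sub_of_left ?_
    rw [degree_pow, degree_X_add_C]
    exact lt_of_le_of_lt degree_C_le (by norm_num)
  refine ⟨monic_prod_of_monic _ _ fun j _ => (h1 j).pow 2, ?_⟩
  rw [interpPoly, natDegree_prod_of_monic _ _ fun j _ => (h1 j).pow 2]
  have h2 : ∀ j : ℕ,
      (((X + C (2 * M + 1 / 2 : ℂ)) ^ 2 - C (((j : ℂ) + 1 / 2) ^ 2) : ℂ[X]) ^ 2).natDegree = 4 :=
    fun j => by
      rw [(h1 j).natDegree_pow, natDegree_sub_C, (monic_X_add_C _).natDegree_pow, natDegree_X_add_C]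
  rw [Finset.sum_congr rfl fun j _ => h2 j, Finset.sum_const, Finset.card_range, smul_eq_mul,
    mul_comm]

theorem eval_interpPoly_natCast (M k : ℕ) : (interpPoly M).eval (k : ℂ) =
    (((2 * M).factorial : ℂ) * ((k + 3 * M).choose (2 * M) : ℂ)) ^ 2 := by
  have h := Nat.ascFactorial_eq_factorial_mul_choose (k + M) (2 * M)
  rw [Nat.ascFactorial_eq_prod_range, show k + M + 2 * M = k + 3 * M by ring] at h
  rw [← Nat.cast_mul, ← h, interpPoly, Polynomial.eval_prod]
  push_cast
  rw [← prod_sub_mul_add_eq_ascFactorial M ((k : ℂ) + M), ← Finset.prod_pow]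
  refine Finset.prod_congr rfl fun j _ => ?_
  simp
  ring

theorem eval_interpPoly_neg (M : ℕ) (d : ℂ) : (interpPoly M).eval (-(2 * M + 1 / 2 + d)) =
    ∏ j ∈ Finset.range M, (((j : ℂ) + 1 / 2) ^ 2 - d ^ 2) ^ 2 := by
  rw [interpPoly, Polynomial.eval_prod]
  refine Finset.prod_congr rfl fun j _ => ?_
  simp
  ring

theorem sum_interpWeight (M : ℕ) :
    ∑ k ∈ Finset.range (4 * M + 1), interpWeight M k = 1 := by
  obtain ⟨hm, hd⟩ := interpPoly_monic_natDegree M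
  have h := sum_choose_mul_eval hd.le
  have hc : (interpPoly M).coeff (4 * M) = 1 := by rw [← hd]; exact hm
  have hf : (((4 * M).factorial : ℕ) : ℂ) ≠ 0 := Nat.cast_ne_zero.2 (Nat.factorial_ne_zero _)
  rw [hc, mul_one] at h
  have : ((∑ k ∈ Finset.range (4 * M + 1), interpWeight M k : ℝ) : ℂ) = 1 := by
    rw [← div_self hf, ← h, Finset.sum_div]
    push_cast
    refine Finset.sum_congr rfl fun k hk => ?_
    have hle := Nat.lt_succ_iff.1 (Finset.mem_range.1 hk)
    have hsg : (-1 : ℂ) ^ (4 * M - k) = (-1) ^ k := by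
      refine neg_one_pow_congr ?_
      rw [Nat.even_sub hle]
      simp [show Even (4 * M) from ⟨2 * M, by ring⟩]
    rw [interpWeight, eval_interpPoly_natCast, hsg, h]
    push_cast
    rfl
  exact_mod_cast this

theorem sum_interpWeight_div (M : ℕ) {d : ℂ} (hd : ∀ k : ℕ, (2 * M + 1 / 2 + d : ℂ) + k ≠ 0) :
    ∑ k ∈ Finset.range (4 * M + 1), (interpWeight M k : ℂ) / (2 * M + 1 / 2 + d + k) =
      (∏ j ∈ Finset.range M, (((j : ℂ) + 1 / 2) ^ 2 - d ^ 2) ^ 2) /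
        ∏ k ∈ Finset.range (4 * M + 1), (2 * M + 1 / 2 + d + k : ℂ) := by
  have h := sum_choose_mul_eval_div (interpPoly_monic_natDegree M).2.le hd
  have hf : (((4 * M).factorial : ℕ) : ℂ) ≠ 0 := Nat.cast_ne_zero.2 (Nat.factorial_ne_zero _)
  rw [eval_interpPoly_neg, mul_div_assoc] at h
  rw [← mul_right_inj' hf, ← h, Finset.mul_sum]
  refine Finset.sum_congr rfl fun k _ => ?_
  rw [interpWeight, eval_interpPoly_natCast]
  push_cast
  field_simp

/-- The value at the centre `2 * M + 1 / 2` of the rational function with partial fraction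
coefficients `interpWeight M`. -/
noncomputable def centralValue (M : ℕ) : ℝ :=
  (∏ j ∈ Finset.range M, ((j : ℝ) + 1 / 2) ^ 2) ^ 2 /
    ∏ k ∈ Finset.range (4 * M + 1), (2 * M + 1 / 2 + k : ℝ)

theorem centralValue_pos (M : ℕ) : 0 < centralValue M :=
  div_pos (pow_pos (Finset.prod_pos fun j _ => by positivity) 2)
    (Finset.prod_pos fun k _ => by positivity)

/-! ### Bounding the weighted error by the central value. -/

theorem eulerMascheroniConstant_sub_eulerS (m : ℕ) :
    Real.eulerMascheroniConstant - eulerS m =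
      Real.log ((m + 1) / (m + 1 / 2)) - binetHalf (m + 1 / 2) := by
  have h := harmonic_eq_log_add_binetHalf m
  rw [harmonic_eq_sum_Icc] at h
  push_cast at h
  rw [Real.log_div (by positivity) (by positivity), eulerS]
  simp only [one_div] at h ⊢
  linarith

/-- Moving right from the centre by at most `1/2`, the distance to the nearest zero, shrinks every
numerator factor and enlarges every denominator factor. -/
theorem abs_sum_interpWeight_div_le (M : ℕ) {d : ℝ} (h0 : 0 ≤ d) (h1 : d ≤ 1 / 2) :
    |∑ k ∈ Finset.range (4 * M + 1), interpWeight M k / (2 * M + 1 / 2 + d + k)| ≤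
      centralValue M := by
  have h := sum_interpWeight_div M (d := d) (fun k => by
    have : (0 : ℝ) < 2 * M + 1 / 2 + d + k := by positivity
    have := Complex.ofReal_ne_zero.2 this.ne'
    push_cast at this
    exact this)
  have h' : ∑ k ∈ Finset.range (4 * M + 1), interpWeight M k / (2 * M + 1 / 2 + d + k) =
      (∏ j ∈ Finset.range M, (((j : ℝ) + 1 / 2) ^ 2 - d ^ 2) ^ 2) /
        ∏ k ∈ Finset.range (4 * M + 1), (2 * M + 1 / 2 + d + k : ℝ) := by
    apply Complex.ofReal_injective
    push_cast
    exact h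
  rw [h', abs_of_nonneg (div_nonneg (Finset.prod_nonneg fun j _ => sq_nonneg _)
    (Finset.prod_nonneg fun k _ => by positivity)), centralValue, ← Finset.prod_pow]
  have hden : 0 < ∏ k ∈ Finset.range (4 * M + 1), (2 * M + 1 / 2 + k : ℝ) :=
    Finset.prod_pos fun k _ => by positivity
  refine div_le_div₀ (Finset.prod_nonneg fun j _ => by positivity) ?_ hden ?_
  · refine Finset.prod_le_prod (fun j _ => by positivity) fun j _ => ?_
    refine pow_le_pow_left₀ ?_ (by linarith [sq_nonneg d]) 2
    have : (0 : ℝ) ≤ j := j.cast_nonneg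
    nlinarith
  · refine Finset.prod_le_prod (fun j _ => by positivity) fun j _ => by linarith

theorem log_div_eq_intervalIntegral {a : ℝ} (ha : 0 < a) :
    Real.log ((a + 1 / 2) / a) = ∫ d in (0 : ℝ)..(1 / 2), 1 / (a + d) := by
  have := integral_one_div_of_pos ha (by linarith : 0 < a + 1 / 2)
  rw [← this, intervalIntegral.integral_comp_add_left (fun x => 1 / x) a, add_zero]

theorem abs_sum_interpWeight_mul_log_le (M : ℕ) :
    |∑ k ∈ Finset.range (4 * M + 1), interpWeight M k *
      Real.log ((2 * M + 1 / 2 + k + 1 / 2) / (2 * M + 1 / 2 + k))| ≤ centralValue M * (1 / 2) := by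
  have hint : ∀ k ∈ Finset.range (4 * M + 1), IntervalIntegrable
      (fun d : ℝ => interpWeight M k * (1 / (2 * M + 1 / 2 + k + d))) volume 0 (1 / 2) := by
    intro k _
    refine ContinuousOn.intervalIntegrable fun d hd => ?_
    rw [uIcc_of_le (by norm_num)] at hd
    have hd0 := hd.1
    have : 2 * (M : ℝ) + 1 / 2 + k + d ≠ 0 := by positivity
    exact ContinuousAt.continuousWithinAt (by fun_prop (disch := assumption))
  have e : ∑ k ∈ Finset.range (4 * M + 1), interpWeight M k *
      Real.log ((2 * M + 1 / 2 + k + 1 / 2) / (2 * M + 1 / 2 + k)) =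
      ∫ d in (0 : ℝ)..(1 / 2), ∑ k ∈ Finset.range (4 * M + 1),
        interpWeight M k * (1 / (2 * M + 1 / 2 + k + d)) := by
    rw [intervalIntegral.integral_finsetSum hint]
    refine Finset.sum_congr rfl fun k _ => ?_
    rw [intervalIntegral.integral_const_mul, log_div_eq_intervalIntegral (by positivity)]
  rw [e, ← Real.norm_eq_abs]
  refine (intervalIntegral.norm_integral_le_of_norm_le_const (C := centralValue M)
    fun d hd => ?_).trans (by norm_num)
  rw [uIoc_of_le (by norm_num)] at hd
  refine le_trans (le_of_eq ?_) (abs_sum_interpWeight_div_le M hd.1.le hd.2)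
  rw [Real.norm_eq_abs]
  refine congrArg _ (Finset.sum_congr rfl fun k _ => ?_)
  rw [mul_one_div]
  congr 1
  ring

/-- Most factors are bounded below by their real parts. The two with `k = 0, 1` have real part at
most `2M + 3/2`, so each gains a further `√q`; together they supply the quadratic decay that makes
the later integral converge. -/
theorem prod_mul_one_add_sq_le_norm_prod {M : ℕ} (hM : 0 < M) (t : ℝ) :
    (∏ k ∈ Finset.range (4 * M + 1), (2 * M + 1 / 2 + k : ℝ)) *
      (1 + ((2 * (M : ℝ) + 3 / 2)⁻¹ * t) ^ 2) ≤
      ‖∏ k ∈ Finset.range (4 * M + 1), (2 * M + 1 / 2 + t * Complex.I + k : ℂ)‖ := by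
  set q : ℝ := 1 + ((2 * (M : ℝ) + 3 / 2)⁻¹ * t) ^ 2 with hq
  have hq0 : 0 < q := by positivity
  have hk : ∀ k : ℕ, ‖(2 * M + 1 / 2 + t * Complex.I + k : ℂ)‖ =
      √((2 * M + 1 / 2 + k) ^ 2 + t ^ 2) := fun k => by
    rw [show (2 * M + 1 / 2 + t * Complex.I + k : ℂ) =
      ((2 * M + 1 / 2 + k : ℝ) : ℂ) + (t : ℝ) * Complex.I by push_cast; ring,
      Complex.norm_add_mul_I]
  have hge : ∀ k : ℕ, (2 * M + 1 / 2 + k : ℝ) ≤ ‖(2 * M + 1 / 2 + t * Complex.I + k : ℂ)‖ :=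
    fun k => by
      rw [hk]
      exact Real.le_sqrt_of_sq_le (by linarith [sq_nonneg t])
  have hge' : ∀ k : ℕ, k ≤ 1 →
      (2 * M + 1 / 2 + k : ℝ) * √q ≤ ‖(2 * M + 1 / 2 + t * Complex.I + k : ℂ)‖ := fun k hk1 => by
    rw [hk]
    refine Real.le_sqrt_of_sq_le ?_
    rw [mul_pow, Real.sq_sqrt hq0.le, hq, mul_add, mul_one, add_le_add_iff_left, mul_pow,
      ← mul_assoc, ← mul_pow]
    refine mul_le_of_le_one_left (sq_nonneg t) (pow_le_one₀ (by positivity) ?_)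
    rw [← div_eq_mul_inv, div_le_one (by positivity)]
    have : (k : ℝ) ≤ 1 := by exact_mod_cast hk1
    linarith
  -- Two factors are available only because `M > 0`.
  obtain ⟨m, hm⟩ : ∃ m, 4 * M + 1 = m + 1 + 1 := ⟨4 * M - 1, by omega⟩
  rw [norm_prod, hm, Finset.prod_range_succ', Finset.prod_range_succ', Finset.prod_range_succ',
    Finset.prod_range_succ', mul_assoc, mul_assoc, mul_assoc]
  refine mul_le_mul (Finset.prod_le_prod (fun k _ => by positivity) fun k _ => hge _) ?_
    (by positivity) (Finset.prod_nonneg fun k _ => norm_nonneg _)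
  refine le_trans (le_of_eq ?_) (mul_le_mul (hge' (0 + 1) (by norm_num)) (hge' 0 (by norm_num))
    (by positivity) (norm_nonneg _))
  have := Real.mul_self_sqrt hq0.le
  linear_combination (-(2 * (M : ℝ) + 1 / 2 + (0 + 1 : ℕ)) * (2 * M + 1 / 2 + (0 : ℕ))) * this

theorem norm_sum_interpWeight_div_le {M : ℕ} (hM : 0 < M) {t : ℝ} (ht : 0 < t) :
    ‖∑ k ∈ Finset.range (4 * M + 1),
      (interpWeight M k : ℂ) / (2 * M + 1 / 2 + t * Complex.I + k)‖ ≤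
      centralValue M * Real.cosh (Real.pi * t) ^ 2 * (1 + ((2 * (M : ℝ) + 3 / 2)⁻¹ * t) ^ 2)⁻¹ := by
  rw [sum_interpWeight_div M fun k h => ht.ne' (by simpa using congrArg Complex.im h), norm_div]
  have hnum : ∏ j ∈ Finset.range M, (((j : ℂ) + 1 / 2) ^ 2 - (t * Complex.I) ^ 2) ^ 2 =
      (((∏ j ∈ Finset.range M, (((j : ℝ) + 1 / 2) ^ 2 + t ^ 2)) ^ 2 : ℝ) : ℂ) := by
    rw [← Finset.prod_pow]
    push_cast
    refine Finset.prod_congr rfl fun j _ => ?_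
    rw [mul_pow, Complex.I_sq]
    ring
  rw [hnum, Complex.norm_real, Real.norm_of_nonneg (by positivity)]
  have hden : 0 < ∏ k ∈ Finset.range (4 * M + 1), (2 * M + 1 / 2 + k : ℝ) :=
    Finset.prod_pos fun k _ => by positivity
  refine (div_le_div₀ (by positivity) (pow_le_pow_left₀ (Finset.prod_nonneg fun j _ => by positivity)
    (prod_sq_add_sq_le ht M) 2) (by positivity) (prod_mul_one_add_sq_le_norm_prod hM t)).trans
    (le_of_eq ?_)
  rw [centralValue, mul_pow]
  generalize ∏ j ∈ Finset.range M, ((j : ℝ) + 1 / 2) ^ 2 = A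
  field_simp

theorem integrableOn_and_integral_inv_one_add_inv_mul_sq {a : ℝ} (ha : 0 < a) :
    IntegrableOn (fun t : ℝ => (1 + (a⁻¹ * t) ^ 2)⁻¹) (Ioi 0) ∧
      ∫ t in Ioi (0 : ℝ), (1 + (a⁻¹ * t) ^ 2)⁻¹ = a * (Real.pi / 2) := by
  constructor
  · refine (integrableOn_Ioi_comp_mul_left_iff (fun t : ℝ => (1 + t ^ 2)⁻¹) 0 (inv_pos.2 ha)).2 ?_
    exact integrable_inv_one_add_sq.integrableOn
  · rw [integral_comp_mul_left_Ioi (fun t : ℝ => (1 + t ^ 2)⁻¹) 0 (inv_pos.2 ha)]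
    simp

/-- The kernel `2t/(t² + a²)` is `-2 Im 1/(a + it)`, so the integrand is controlled by `R` on the
vertical line. The growth `cosh² (πt)` cancels against `2/(exp (2πt) + 1)`, leaving an arctangent
integral. -/
theorem abs_sum_interpWeight_mul_binetHalf_le {M : ℕ} (hM : 0 < M) :
    |∑ k ∈ Finset.range (4 * M + 1), interpWeight M k * binetHalf (2 * M + 1 / 2 + k)| ≤
      centralValue M * ((2 * M + 3 / 2) * (Real.pi / 2)) := by
  have hi := fun k : ℕ => (integrableOn_binetHalf
    (x := 2 * (M : ℝ) + 1 / 2 + k) (by positivity)).const_mul (interpWeight M k)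
  obtain ⟨hq, hq'⟩ := integrableOn_and_integral_inv_one_add_inv_mul_sq
    (a := 2 * (M : ℝ) + 3 / 2) (by positivity)
  simp only [binetHalf, ← integral_const_mul]
  rw [← integral_finsetSum _ fun k _ => hi k, ← hq', ← integral_const_mul, ← Real.norm_eq_abs]
  refine norm_integral_le_of_norm_le (hq.const_mul _)
    ((ae_restrict_iff' measurableSet_Ioi).2 (ae_of_all _ fun t ht => ?_))
  have ht : 0 < t := ht
  have hE : 0 < Real.exp (2 * Real.pi * t) + 1 := by positivity
  have hIm : ∑ k ∈ Finset.range (4 * M + 1), interpWeight M k *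
      (2 * t / (t ^ 2 + (2 * M + 1 / 2 + k) ^ 2) / (Real.exp (2 * Real.pi * t) + 1)) =
      -(∑ k ∈ Finset.range (4 * M + 1),
        (interpWeight M k : ℂ) / (2 * M + 1 / 2 + t * Complex.I + k)).im *
        (2 / (Real.exp (2 * Real.pi * t) + 1)) := by
    rw [Complex.im_sum, ← Finset.sum_neg_distrib, Finset.sum_mul]
    refine Finset.sum_congr rfl fun k _ => ?_
    rw [show (2 * M + 1 / 2 + t * Complex.I + k : ℂ) =
      ((2 * M + 1 / 2 + k : ℝ) : ℂ) + (t : ℝ) * Complex.I by push_cast; ring, Complex.div_im,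
      Complex.normSq_add_mul_I]
    simp only [Complex.ofReal_im, Complex.ofReal_re, Complex.add_re, Complex.add_im,
      Complex.re_ofReal_mul, Complex.im_ofReal_mul, Complex.I_re, Complex.I_im]
    have : t ^ 2 + (2 * (M : ℝ) + 1 / 2 + k) ^ 2 ≠ 0 := by positivity
    rw [add_comm _ (t ^ 2)]
    generalize 2 * (M : ℝ) + 1 / 2 + k = a at *
    field_simp
    ring
  rw [hIm, norm_mul, norm_neg, Real.norm_eq_abs, Real.norm_of_nonneg (by positivity)]
  have hb := (Complex.abs_im_le_norm _).trans (norm_sum_interpWeight_div_le hM ht)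
  refine (mul_le_mul_of_nonneg_right hb (by positivity)).trans ?_
  have hc := two_mul_cosh_sq_le (Real.pi * t) (by positivity)
  rw [← mul_assoc 2] at hc
  have hr := centralValue_pos M
  have : Real.cosh (Real.pi * t) ^ 2 * (2 / (Real.exp (2 * Real.pi * t) + 1)) ≤ 1 := by
    rw [mul_div_assoc', div_le_one hE]
    linarith
  calc _ = centralValue M * (1 + ((2 * (M : ℝ) + 3 / 2)⁻¹ * t) ^ 2)⁻¹ *
        (Real.cosh (Real.pi * t) ^ 2 * (2 / (Real.exp (2 * Real.pi * t) + 1))) := by ring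
    _ ≤ _ := mul_le_of_le_one_right (by positivity) this

theorem abs_sum_interpWeight_mul_sub_eulerS_le {M : ℕ} (hM : 0 < M) :
    |∑ k ∈ Finset.range (4 * M + 1),
      interpWeight M k * (Real.eulerMascheroniConstant - eulerS (k + 2 * M))| ≤
      centralValue M * (1 / 2 + (2 * M + 3 / 2) * (Real.pi / 2)) := by
  have e : ∀ k : ℕ, interpWeight M k * (Real.eulerMascheroniConstant - eulerS (k + 2 * M)) =
      interpWeight M k * Real.log ((2 * M + 1 / 2 + k + 1 / 2) / (2 * M + 1 / 2 + k)) -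
      interpWeight M k * binetHalf (2 * M + 1 / 2 + k) := fun k => by
    rw [eulerMascheroniConstant_sub_eulerS, mul_sub]
    push_cast
    ring_nf
  rw [Finset.sum_congr rfl fun k _ => e k, Finset.sum_sub_distrib, mul_add]
  exact (abs_sub _ _).trans (add_le_add (abs_sum_interpWeight_mul_log_le M)
    (abs_sum_interpWeight_mul_binetHalf_le hM))

/-! ### Geometric decay of the central value and the final constants. -/

/-- Raising `n` by one drops four denominator factors near `4n`, adds twelve near `12n`, and adds
numerator factors of size `(2n)^8`. The leading-order ratio is `1/(2^8 · 3^12)`, so `2^4 · 3^12`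
leaves room for the lower-order terms. -/
theorem centralValue_ratio_le (n : ℕ) :
    centralValue (2 * (n + 1)) * ((2 : ℝ) ^ 4 * 3 ^ 12) ≤ centralValue (2 * n) := by
  have hD : (∏ k ∈ Finset.range 4, (4 * n + 1 / 2 + k : ℝ)) *
      ∏ k ∈ Finset.range (4 * (2 * (n + 1)) + 1), (2 * (2 * (n + 1) : ℕ) + 1 / 2 + k : ℝ) =
      (∏ k ∈ Finset.range (4 * (2 * n) + 1), (2 * (2 * n : ℕ) + 1 / 2 + k : ℝ)) *
      ∏ k ∈ Finset.range 12, (12 * n + 3 / 2 + k : ℝ) := by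
    have h := (Finset.prod_range_add (fun k : ℕ => (4 * n + 1 / 2 + k : ℝ)) 4
      (4 * (2 * (n + 1)) + 1)).symm
    rw [show 4 + (4 * (2 * (n + 1)) + 1) = 4 * (2 * n) + 1 + 12 by ring,
      Finset.prod_range_add _ (4 * (2 * n) + 1) 12] at h
    convert h using 2 <;> refine Finset.prod_congr rfl fun k _ => ?_ <;> push_cast <;> ring
  have hT : ((2 * n + 1 / 2 : ℝ) ^ 2 * (2 * n + 1 + 1 / 2) ^ 2) ^ 2 * ((2 : ℝ) ^ 4 * 3 ^ 12) *
      ∏ k ∈ Finset.range 4, (4 * n + 1 / 2 + k : ℝ) ≤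
      ∏ k ∈ Finset.range 12, (12 * n + 3 / 2 + k : ℝ) := by
    -- Thanks to that slack, the difference expands to a polynomial in `n` without negative
    -- coefficients.
    rw [← sub_nonneg]
    simp only [Finset.prod_range_succ, Finset.prod_range_zero]
    push_cast
    ring_nf
    positivity
  have hF : 0 < ∏ k ∈ Finset.range 4, (4 * n + 1 / 2 + k : ℝ) :=
    Finset.prod_pos fun k _ => by positivity
  have hA : 0 < ∏ k ∈ Finset.range (4 * (2 * n) + 1), (2 * (2 * n : ℕ) + 1 / 2 + k : ℝ) :=
    Finset.prod_pos fun k _ => by positivity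
  have hB : 0 < ∏ k ∈ Finset.range (4 * (2 * (n + 1)) + 1),
      (2 * (2 * (n + 1) : ℕ) + 1 / 2 + k : ℝ) := Finset.prod_pos fun k _ => by positivity
  rw [centralValue, centralValue, div_mul_eq_mul_div, div_le_div_iff₀ hB hA,
    show 2 * (n + 1) = 2 * n + 1 + 1 by ring] at *
  rw [Finset.prod_range_succ, Finset.prod_range_succ _ (2 * n)]
  refine le_of_mul_le_mul_left ?_ hF
  rw [mul_left_comm, mul_left_comm _ (_ ^ 2), hD]
  generalize ∏ k ∈ Finset.range (4 * (2 * n) + 1), (2 * (2 * n : ℕ) + 1 / 2 + k : ℝ) = A at *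
  have hN : 0 ≤ (∏ j ∈ Finset.range (2 * n), ((j : ℝ) + 1 / 2) ^ 2) ^ 2 * A := by positivity
  have := mul_le_mul_of_nonneg_left hT hN
  push_cast
  linarith

theorem centralValue_two_mul_le (n : ℕ) :
    centralValue (2 * (n + 1)) * ((2 : ℝ) ^ 4 * 3 ^ 12) ^ (n + 1) ≤ 1 / 54 := by
  induction n with
  -- The left side is about `0.0183` here, just below `1/54`.
  | zero =>
    norm_num [centralValue, Finset.prod_range_succ]
  | succ n ih =>
    refine le_trans ?_ ih
    rw [pow_succ' _ (n + 1), ← mul_assoc]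
    exact mul_le_mul_of_nonneg_right (centralValue_ratio_le (n + 1)) (by positivity)

theorem corollary2p5 (n : ℕ) (hn : 0 < n) :
    |Real.eulerMascheroniConstant -
        ((Nat.factorial (4 * n) : ℝ) ^ 2 / (Nat.factorial (8 * n) : ℝ)) *
          ∑ k ∈ Finset.range (8 * n + 1),
            (-1 : ℝ) ^ k * (Nat.choose (8 * n) k : ℝ) *
              (Nat.choose (k + 6 * n) (4 * n) : ℝ) ^ 2 * eulerS (k + 4 * n)|
        < 4 * (n : ℝ) / ((2 : ℝ) ^ 4 * (3 : ℝ) ^ 12) ^ n ∧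
      4 * (n : ℝ) / ((2 : ℝ) ^ 4 * (3 : ℝ) ^ 12) ^ n
        < 4 * (n : ℝ) * (0.00000012 : ℝ) ^ n := by
  have hn' : (1 : ℝ) ≤ n := by exact_mod_cast hn
  constructor
  · have h := abs_sum_interpWeight_mul_sub_eulerS_le (M := 2 * n) (by omega)
    have e : ∑ k ∈ Finset.range (4 * (2 * n) + 1), interpWeight (2 * n) k *
        (Real.eulerMascheroniConstant - eulerS (k + 2 * (2 * n))) =
        Real.eulerMascheroniConstant -
        ((Nat.factorial (4 * n) : ℝ) ^ 2 / (Nat.factorial (8 * n) : ℝ)) *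
          ∑ k ∈ Finset.range (8 * n + 1),
            (-1 : ℝ) ^ k * (Nat.choose (8 * n) k : ℝ) *
              (Nat.choose (k + 6 * n) (4 * n) : ℝ) ^ 2 * eulerS (k + 4 * n) := by
      simp only [mul_sub, Finset.sum_sub_distrib, ← Finset.sum_mul, sum_interpWeight, one_mul]
      rw [Finset.mul_sum, ← mul_assoc 4 2 n, ← mul_assoc 2 2 n]
      norm_num only
      refine congrArg _ (Finset.sum_congr rfl fun k _ => ?_)
      rw [interpWeight, ← mul_assoc 4 2 n, ← mul_assoc 2 2 n, ← mul_assoc 3 2 n]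
      norm_num only
      ring
    rw [e] at h
    refine h.trans_lt ?_
    obtain ⟨m, rfl⟩ := Nat.exists_eq_succ_of_ne_zero hn.ne'
    have hc := centralValue_two_mul_le m
    have hpos : (0 : ℝ) < ((2 : ℝ) ^ 4 * 3 ^ 12) ^ (m + 1) := by positivity
    rw [lt_div_iff₀ hpos, mul_right_comm]
    -- A crude bound suffices: with `π < 4` the total is below `(8n + 7/2)/54`, far less than `4n`.
    have hpi := Real.pi_lt_four
    refine (mul_le_mul_of_nonneg_right hc (by positivity)).trans_lt ?_
    push_cast at hn' ⊢
    nlinarith [Real.pi_pos]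
  · rw [div_eq_mul_inv, ← inv_pow]
    refine mul_lt_mul_of_pos_left (pow_lt_pow_left₀ ?_ (by positivity) hn.ne') (by positivity)
    norm_num
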